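/- There is a universal constant $\Theta\in[0,\infty)$ with the following property. Let $n\ge 3$ and $R>0$, let $B_R=\{(x,y)\in\mathbb R^2: x^2+y^2\le R^2\}$ and $B=\{(u,v)\in\mathbb R^2:u^2+v^2\le 1\}$, and let $\varphi_1,\dots,\varphi_{n-2}\in C^3(B_R,\mathbb R)$ be such that the graph $$X(x,y)=(x,y,\varphi_1(x,y),\dots,\varphi_{n-2}(x,y)),\qquad (x,y)\in B_R,$$ is a minimal surface in $\mathbb R^n$, i.e. its mean curvature along every unit normal vector vanishes. Let this graph be represented in conformal parameters on $B$, with centre corresponding to centre: $Y(u,v)=X(z(u,v))$, where $z:B\to B_R$ is a homeomorphism with $z(0,0)=(0,0)$, and $Y(u,v)$ is of class $C^3$ in the interior of $B$ and satisfies there $$|Y_u|^2=W=|Y_v|^2,\qquad Y_u\cdot Y_v=0,\qquad W:=\sqrt{|Y_u|^2|Y_v|^2-(Y_u\cdot Y_v)^2}>0 .$$ For every unit normal section $N$ of $Y(u,v)$, i.e. $|N|=1$ and $N\cdot Y_u=N\cdot Y_v=0$, let $$K_N=\frac{(Y_{uu}\cdot N)(Y_{vv}\cdot N)-(Y_{uv}\cdot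 N)^2}{W^2}$$ be the Gaussian curvature along $N$. Then $$|K_N(0,0)|\le\frac{\Theta}{R^4}\,\|X\|_{C^0(B_R)}^2,\qquad \|X\|_{C^0(B_R)}:=\sup_{(x,y)\in B_R}|X(x,y)| .$$ The constant $\Theta$ depends neither on $n$ and $R$ nor on the graph, its parametrization or $N$. -/

import Mathlib

noncomputable section

namespace MinimalGraph

/-- `ℝⁿ` with the Euclidean norm. -/
abbrev E (n : ℕ) : Type := EuclideanSpace ℝ (Fin n)

/-- The partial derivative of `f : ℝ² → F` in the `i`-th parameter (`0` is `u`, `1` is `v`). -/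
def pd {F : Type*} [NormedAddCommGroup F] [NormedSpace ℝ F]
    (i : Fin 2) (f : E 2 → F) (w : E 2) : F :=
  fderiv ℝ f w (EuclideanSpace.single i 1)

section Surface

variable {n : ℕ}

/-- Coefficients `g_{ij} = X_{u^i} · X_{u^j}` of the first fundamental form. -/
def firstForm (X : E 2 → E n) (i j : Fin 2) (w : E 2) : ℝ :=
  inner ℝ (pd i X w) (pd j X w)

/-- The surface area element `W = √(g₁₁ g₂₂ - g₁₂²)`. -/
def areaElement (X : E 2 → E n) (w : E 2) : ℝ :=
  Real.sqrt (firstForm X 0 0 w * firstForm X 1 1 w - firstForm X 0 1 w ^ 2)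

/-- Coefficients `L_{ν,ij} = X_{u^i u^j} · ν` of the second fundamental form along the
vector `ν`, at the parameter point `w`. -/
def secondForm (X : E 2 → E n) (ν : E n) (i j : Fin 2) (w : E 2) : ℝ :=
  inner ℝ (pd j (pd i X) w) ν

/-- `ν` is a unit normal vector of `X` at `w`. -/
def IsUnitNormalAt (X : E 2 → E n) (ν : E n) (w : E 2) : Prop :=
  ‖ν‖ = 1 ∧ ∀ i : Fin 2, inner ℝ (pd i X w) ν = 0

/-- The Gaussian curvature along `ν`: `K_ν = (L_{ν,11} L_{ν,22} - L_{ν,12}²) / W²`. -/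
def gaussCurvature (X : E 2 → E n) (ν : E n) (w : E 2) : ℝ :=
  (secondForm X ν 0 0 w * secondForm X ν 1 1 w - secondForm X ν 0 1 w ^ 2)
    / areaElement X w ^ 2

/-- The mean curvature along `ν`: `H_ν = ½ ∑ g^{ij} L_{ν,ij}`. -/
def meanCurvature (X : E 2 → E n) (ν : E n) (w : E 2) : ℝ :=
  (firstForm X 1 1 w * secondForm X ν 0 0 w - 2 * firstForm X 0 1 w * secondForm X ν 0 1 w
      + firstForm X 0 0 w * secondForm X ν 1 1 w) / (2 * areaElement X w ^ 2)

/-- The mean curvature of `X` vanishes along every unit normal vector, at every point of `s`. -/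
def IsMinimalOn (X : E 2 → E n) (s : Set (E 2)) : Prop :=
  ∀ w ∈ s, ∀ ν : E n, IsUnitNormalAt X ν w → meanCurvature X ν w = 0

/-- `X` is an immersion in conformal parameters on `s`:
`|X_u|² = W = |X_v|²`, `X_u · X_v = 0` and `W > 0`. -/
def IsConformalImmersionOn (X : E 2 → E n) (s : Set (E 2)) : Prop :=
  ∀ w ∈ s, 0 < areaElement X w ∧ firstForm X 0 0 w = areaElement X w ∧
    firstForm X 1 1 w = areaElement X w ∧ firstForm X 0 1 w = 0

end Surface

/-- The graph `(x, y) ↦ (x, y, φ₁(x,y), …, φₘ(x,y))` in `ℝ^{m+2}`. -/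
def graph {m : ℕ} (φ : Fin m → E 2 → ℝ) (p : E 2) : E (m + 2) :=
  WithLp.toLp 2 (Matrix.vecCons (p 0) (Matrix.vecCons (p 1) (fun k => φ k p)))

/-- `φ₁, …, φₘ` are of class `C³` on the closed disc `B_R`, and their graph is a
minimal surface. -/
structure IsMinimalGraph {m : ℕ} (R : ℝ) (φ : Fin m → E 2 → ℝ) : Prop where
  contDiffOn : ∀ k, ContDiffOn ℝ 3 (φ k) (Metric.closedBall 0 R)
  minimal : IsMinimalOn (graph φ) (Metric.ball 0 R)

/-- `X` represents the graph of `φ` over the closed disc `B_R` in conformal parameters on the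
closed unit disc `B`, centre going to centre. A continuous bijection `z` of `B` onto `B_R` is a
homeomorphism by compactness; regularity and conformality are only asked in the interior. -/
structure IsConformalParametrization {m : ℕ} (R : ℝ) (φ : Fin m → E 2 → ℝ)
    (X : E 2 → E (m + 2)) : Prop where
  reparam : ∃ z : E 2 → E 2, ContinuousOn z (Metric.closedBall 0 1) ∧
    Set.BijOn z (Metric.closedBall 0 1) (Metric.closedBall 0 R) ∧ z 0 = 0 ∧
    ∀ w ∈ Metric.closedBall (0 : E 2) 1, X w = graph φ (z w)
  contDiffOn : ContDiffOn ℝ 3 X (Metric.ball 0 1)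
  conformal : IsConformalImmersionOn X (Metric.ball 0 1)

/-- `‖X‖_{C⁰(B_R)}`, the supremum of `|X(x,y)|` over the closed disc `B_R`, for the graph of `φ`. -/
def graphSupNorm {m : ℕ} (R : ℝ) (φ : Fin m → E 2 → ℝ) : ℝ :=
  sSup ((fun p => ‖graph φ p‖) '' Metric.closedBall 0 R)

end MinimalGraph

end

namespace MinimalGraph

/-! ### Harmonic functions on the unit disc -/

section

open Metric InnerProductSpace Complex ComplexConjugate

/-! In conformal parameters a minimal surface has harmonic components, in every codimension:
differentiating the conformality relations shows that `X_uu + X_vv` is normal, and vanishing mean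
curvature kills its normal part (`laplace_eq_zero`). The curvature at the centre is then a quotient
with two independent estimates.

Numerator: `X · ν` is harmonic and bounded by the sup norm `M`, so its second derivatives at the
centre are at most `40 M`, by Borel–Carathéodory for a holomorphic completion and Cauchy's estimate
(`norm_fderiv_fderiv_le`).

Denominator: the plane part `f` of the surface is a harmonic homeomorphism of discs fixing the
centre, and Heinz's inequality (`CircleHomeo.heinz`) bounds its derivative at `0` below by a
multiple of `R`. On the unit circle `Re f` vanishes at exactly two points and changes sign there; so
does the affine function `l₁` whose zero line is the chord through them. Hence, up to the choice of
sign of `l₁`, `Re f * l₁ ≥ 0`, while the mean of this product is half a directional derivative of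
`Re f` at `0`. The same holds for `Im f` and some `l₂`. As `|l₁|, |l₂| ≤ 2`, the two products add up
to at least `(R / 2) |l₁ l₂|`, which is `R / 8` times the modulus of a monic quartic with its roots
on the unit circle. The mean of that modulus is at least its value `1` at the centre. -/

theorem fderiv_apply_of_re_eq {U : ℂ → ℝ} {F : ℂ → ℂ} {s : Set ℂ} (hs : IsOpen s)
    (hF : DifferentiableOn ℂ F s) (h : Set.EqOn (fun w => (F w).re) U s) {w : ℂ} (hw : w ∈ s)
    (v : ℂ) : fderiv ℝ U w v = (deriv F w * v).re := by
  have h1 : HasFDerivAt F _ w := ((hF.differentiableAt (hs.mem_nhds hw)).hasDerivAt.hasFDerivAt).restrictScalars ℝ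
  have h2 := (Complex.reCLM.hasFDerivAt.comp w h1).congr_of_eventuallyEq
    (f₁ := U) (by filter_upwards [hs.mem_nhds hw] with y hy; exact (h hy).symm)
  rw [h2.fderiv]
  simp [mul_comm]

/-- This picks out the first Fourier coefficient of `U`. On the circle of radius `r`, `conj w = r² /
w` turns the integrand into the real part of a holomorphic function, and the mean value property
applies. -/
theorem circleAverage_mul_re_of_lt_one {U : ℂ → ℝ} (hU : HarmonicOnNhd U (ball 0 1)) (α : ℂ)
    {r : ℝ} (h0 : 0 < r) (h1 : r < 1) :
    Real.circleAverage (fun w => U w * (conj α * w).re) 0 r = r ^ 2 * fderiv ℝ U 0 α / 2 := by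
  obtain ⟨F, hF, hre⟩ := hU.exists_analyticOnNhd_ball_re_eq
  have hFd : DifferentiableOn ℂ F (ball 0 1) := hF.differentiableOn
  have hG : AnalyticOnNhd ℂ (dslope F 0) (ball 0 1) :=
    ((Complex.differentiableOn_dslope (isOpen_ball.mem_nhds (by simp))).2 hFd).analyticOnNhd
      isOpen_ball
  -- `α r² (F w - F 0) / (2 w)` comes from `conj w = r² / w`; `dslope` fills in its value at `w =
  -- 0`. The subtracted `F 0` part is restored through its conjugate, which is linear in `w` and has
  -- the same real part.
  set H : ℂ → ℂ := fun w => conj α / 2 * F w * w + α / 2 * r ^ 2 * dslope F 0 w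
    + conj (F 0 * α / 2) * w with hH
  have hHarm : HarmonicOnNhd (fun w => (H w).re) (closedBall 0 |r|) := by
    intro w hw
    have hw' : w ∈ ball (0 : ℂ) 1 := by
      rw [abs_of_pos h0] at hw
      exact closedBall_subset_ball h1 hw
    have a1 := hF w hw'
    have a2 := hG w hw'
    apply AnalyticAt.harmonicAt_re
    exact ((((analyticAt_const.mul a1).mul analyticAt_id)).add (analyticAt_const.mul a2)).add
      (analyticAt_const.mul analyticAt_id)
  have key : Real.circleAverage (fun w => U w * (conj α * w).re) 0 r
      = Real.circleAverage (fun w => (H w).re) 0 r := by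
    apply Real.circleAverage_congr_sphere
    intro w hw
    rw [abs_of_pos h0] at hw
    have hw' : w ∈ ball (0 : ℂ) 1 := by
      exact closedBall_subset_ball h1 (sphere_subset_closedBall hw)
    have hn : ‖w‖ = r := by simpa using hw
    have hw0 : w ≠ 0 := by
      rintro rfl; simp at hn; exact h0.ne hn
    have hc : w * conj w = (r : ℂ) ^ 2 := by
      rw [Complex.mul_conj, Complex.normSq_eq_norm_sq, hn]; push_cast; ring
    have hFw : F w = F 0 + w * dslope F 0 w := by
      rw [dslope_of_ne _ hw0, slope_def_field]; field_simp; ring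
    have e2 : H w = F w * (conj α * w) / 2 + (F w - F 0) * (α * conj w) / 2
        + conj (F 0 * α * conj w) / 2 := by
      rw [hH]
      simp only [map_mul, map_div₀, Complex.conj_conj, map_ofNat]
      rw [← hc]
      have : F w - F 0 = w * dslope F 0 w := by rw [hFw]; ring
      rw [this]; ring
    have e3 : (conj (F 0 * α * conj w)).re = (F 0 * α * conj w).re := Complex.conj_re _
    have hU' : U w = (F w).re := (hre hw').symm
    simp only
    rw [e2, hU']
    simp only [Complex.add_re, Complex.div_ofNat_re, e3]
    simp only [Complex.mul_re, Complex.mul_im, Complex.conj_re, Complex.conj_im, Complex.sub_re,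
      Complex.sub_im]
    ring
  rw [key, hHarm.circleAverage_eq, fderiv_apply_of_re_eq isOpen_ball hFd hre (by simp) α]
  simp only [hH, dslope_same, mul_zero, zero_add, add_zero]
  rw [show α / 2 * (r : ℂ) ^ 2 * deriv F 0 = ((r ^ 2 / 2 : ℝ) : ℂ) * (deriv F 0 * α) by
    push_cast; ring, Complex.re_ofReal_mul]
  ring

/-- Harmonicity stops at the open disc, so the unit circle is reached as a limit of radii `r < 1`.
-/
theorem circleAverage_mul_re {U : ℂ → ℝ} (hU : HarmonicOnNhd U (ball 0 1))
    (hc : ContinuousOn U (closedBall 0 1)) (α : ℂ) :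
    Real.circleAverage (fun w => U w * (conj α * w).re) 0 1 = fderiv ℝ U 0 α / 2 := by
  have h := Real.ContinuousOn.eq_of_eqOn_Ioo (r := 0) (R := 1) (c := fderiv ℝ U 0 α / 2)
    (f := fun r => (r ^ 2)⁻¹ * Real.circleAverage (fun w => U w * (conj α * w).re) 0 r) ?_
    one_pos ?_
  · simpa using h
  · apply ContinuousOn.mul
    · apply ContinuousOn.inv₀ (by fun_prop)
      intro x hx
      have := hx.1
      positivity
    · apply Real.ContinuousOn.circleAverage
      · apply ContinuousOn.mul
        · apply hc.mono
          intro w hw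
          simpa using hw.2
        · fun_prop
      · intro x hx
        exact hx.1.le
  · intro r hr
    have : r ≠ 0 := hr.1.ne'
    simp only
    rw [circleAverage_mul_re_of_lt_one hU α hr.1 hr.2]
    field_simp

theorem norm_fderiv_fderiv_le {U : ℂ → ℝ} (hU : HarmonicOnNhd U (ball 0 1)) {M : ℝ}
    (hM : 0 < M) (hb : ∀ w ∈ ball (0 : ℂ) 1, |U w| ≤ M) (v w : ℂ) :
    |fderiv ℝ (fun y => fderiv ℝ U y v) 0 w| ≤ 40 * M * ‖v‖ * ‖w‖ := by
  obtain ⟨F₀, hF₀, hre₀⟩ := hU.exists_analyticOnNhd_ball_re_eq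
  -- The imaginary constant is chosen so that `F 0` is real, hence equal to `U 0` and bounded by
  -- `M`.
  set F : ℂ → ℂ := fun w => F₀ w - (F₀ 0).im * I with hFdef
  have hF : AnalyticOnNhd ℂ F (ball 0 1) := fun w hw => (hF₀ w hw).sub analyticAt_const
  have hre : Set.EqOn (fun w => (F w).re) U (ball 0 1) := by
    intro w hw
    simpa [hFdef] using hre₀ hw
  have hF0 : ‖F 0‖ ≤ M := by
    have h0 := hb 0 (by simp)
    have : F 0 = (U 0 : ℂ) := by
      apply Complex.ext
      · simpa using hre (show (0:ℂ) ∈ ball 0 1 by simp)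
      · simp [hFdef]
    rwa [this, Complex.norm_real]
  have hFd : DifferentiableOn ℂ F (ball 0 1) := hF.differentiableOn
  -- Borel–Carathéodory at radius `1/2` gives `2M + 3 ‖F 0‖`.
  have hsph : ∀ y ∈ sphere (0 : ℂ) (1 / 2), ‖F y‖ ≤ 5 * M := by
    intro y hy
    have hn : ‖y‖ = 1 / 2 := by simpa using hy
    have := Complex.borelCaratheodory hM hFd (fun x hx => ?_) (z := y) one_pos (by simp [hn]; norm_num)
    · rw [hn] at this
      norm_num at this
      linarith
    · have h1 := hre hx
      have h2 := abs_le.1 (hb x hx)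
      simp only at h1
      simp only [Set.mem_ofPred_eq]
      linarith
  -- Cauchy's estimate: `2! * 5M / (1/2)² = 40M`.
  have h2 := Complex.norm_iteratedDeriv_le_of_forall_mem_sphere_norm_le (c := 0) 2
    (by norm_num : (0 : ℝ) < 1 / 2)
    (hFd.mono (by
      rw [closure_ball _ (by norm_num)]
      exact closedBall_subset_ball (by norm_num))).diffContOnCl hsph
  rw [iteratedDeriv_succ, iteratedDeriv_one] at h2
  have hd : DifferentiableOn ℂ (fun y => deriv F y * v) (ball 0 1) :=
    (hF.deriv.differentiableOn).mul_const v
  rw [fderiv_apply_of_re_eq isOpen_ball hd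
    (fun y hy => (fderiv_apply_of_re_eq isOpen_ball hFd hre hy v).symm) (by simp) w]
  have hd0 : DifferentiableAt ℂ (deriv F) 0 := (hF.deriv 0 (by simp)).differentiableAt
  rw [deriv_mul_const hd0]
  refine (Complex.abs_re_le_norm _).trans ?_
  rw [norm_mul, norm_mul]
  gcongr
  refine h2.trans (le_of_eq ?_)
  norm_num [Nat.factorial]
  ring

end

/-! ### Heinz's inequality -/

section

open Metric InnerProductSpace Complex ComplexConjugate

/-- The affine function is the signed distance to the chord `PQ`, with unit normal `α`. Its modulus
is the height of a triangle inscribed in the unit circle: the product of the two adjacent sides over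
twice the circumradius. -/
theorem exists_chord_function {P Q : ℂ} (hP : ‖P‖ = 1) (hQ : ‖Q‖ = 1) (hPQ : P ≠ Q) :
    ∃ (α : ℂ) (β : ℝ), ‖α‖ = 1 ∧
      (∀ w : ℂ, ‖w‖ = 1 → |(conj α * w).re + β| = ‖w - P‖ * ‖w - Q‖ / 2) ∧
      (∃ w : ℂ, ‖w‖ = 1 ∧ 0 < (conj α * w).re + β) ∧
      ∃ w : ℂ, ‖w‖ = 1 ∧ (conj α * w).re + β < 0 := by
  have hD : (0 : ℝ) < ‖Q - P‖ := norm_pos_iff.2 (sub_ne_zero.2 hPQ.symm)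
  set D : ℝ := ‖Q - P‖ with hDdef
  set α : ℂ := I * (Q - P) / D with hα
  have hαn : ‖α‖ = 1 := by
    rw [hα, norm_div, norm_mul, norm_I, one_mul, Complex.norm_real, Real.norm_eq_abs,
      abs_of_pos hD, ← hDdef, div_self hD.ne']
  have unit : ∀ {w : ℂ}, ‖w‖ = 1 → w * conj w = 1 := by
    intro w hw
    rw [Complex.mul_conj, Complex.normSq_eq_norm_sq, hw]; simp
  have hval : ∀ w : ℂ, ‖w‖ = 1 →
      |(conj α * w).re + -(conj α * P).re| = ‖w - P‖ * ‖w - Q‖ / 2 := by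
    intro w hw
    have hP0 : P ≠ 0 := by rintro rfl; simp at hP
    have hQ0 : Q ≠ 0 := by rintro rfl; simp at hQ
    have hw0 : w ≠ 0 := by rintro rfl; simp at hw
    have cP : conj P = P⁻¹ := eq_inv_of_mul_eq_one_right (unit hP)
    have cQ : conj Q = Q⁻¹ := eq_inv_of_mul_eq_one_right (unit hQ)
    have cw : conj w = w⁻¹ := eq_inv_of_mul_eq_one_right (unit hw)
    have hDC : (D : ℂ) ≠ 0 := by exact_mod_cast hD.ne'
    -- Conjugation is inversion on the unit circle, so the affine function becomes rational in `w`
    -- and splits into factors vanishing at `P` and `Q`.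
    have e1 : ((2 * ((conj α * w).re + -(conj α * P).re) : ℝ) : ℂ)
        = I * (Q - P) * (w - P) * (w - Q) / (P * Q * w * D) := by
      have : ((2 * (conj α * (w - P)).re : ℝ) : ℂ) = conj α * (w - P) + conj (conj α * (w - P)) := by
        rw [Complex.add_conj]
      rw [show (conj α * w).re + -(conj α * P).re = (conj α * (w - P)).re by
        rw [mul_sub, Complex.sub_re]; ring, this, hα]
      simp only [map_mul, map_div₀, map_sub, map_neg, map_inv₀, conj_I, Complex.conj_ofReal, cP, cQ, cw,
        inv_inv]
      field_simp
      ring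
    have e2 := congrArg norm e1
    rw [Complex.norm_real, Real.norm_eq_abs, abs_mul, abs_two] at e2
    simp only [norm_div, norm_mul, norm_I, hP, hQ, hw, Complex.norm_real, Real.norm_eq_abs,
      abs_of_pos hD, ← hDdef] at e2
    field_simp at e2 ⊢
    linarith
  have hsq : ∀ w : ℂ, ‖w‖ ^ 2 = w.re ^ 2 + w.im ^ 2 := fun w => by
    rw [← Complex.normSq_eq_norm_sq, Complex.normSq_apply]; ring
  have hlt : |(conj α * P).re| < 1 := by
    have h1 : ‖conj α * P‖ ^ 2 = 1 := by simp [hαn, hP]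
    rw [hsq] at h1
    -- Otherwise `P` is orthogonal to `Q - P`, and `‖P‖ = ‖Q‖` forces `P = Q`.
    have h2 : (conj α * P).im ≠ 0 := by
      intro h
      have h3 : (conj (I * (Q - P)) * P).im = 0 := by
        have : conj (I * (Q - P)) * P = D * (conj α * P) := by
          rw [hα, map_div₀, Complex.conj_ofReal]
          have hDC : (D : ℂ) ≠ 0 := by exact_mod_cast hD.ne'
          field_simp
        rw [this, Complex.im_ofReal_mul, h, mul_zero]
      have p2 := hsq P
      have q2 := hsq Q
      rw [hP] at p2
      rw [hQ] at q2
      simp at h3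
      have : (Q.re - P.re) ^ 2 + (Q.im - P.im) ^ 2 = 0 := by nlinarith
      apply hPQ
      apply Complex.ext <;> nlinarith [sq_nonneg (Q.re - P.re), sq_nonneg (Q.im - P.im)]
    rw [abs_lt]
    have := sq_pos_of_ne_zero h2
    constructor <;> nlinarith
  have h1 := abs_lt.1 hlt
  have hαα : conj α * α = 1 := by rw [mul_comm]; exact unit hαn
  refine ⟨α, -(conj α * P).re, hαn, hval, ⟨α, hαn, ?_⟩, ⟨-α, by simpa using hαn, ?_⟩⟩
  · rw [hαα]; simp only [Complex.one_re]; linarith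
  · rw [mul_neg, hαα]; simp only [Complex.neg_re, Complex.one_re]; linarith

theorem sign_const_on_half_circle {R : ℝ} (hR : 0 < R) {g : ℂ → ℝ}
    (hg : ContinuousOn g (sphere 0 R)) {s : ℝ} (hs : |s| = 1)
    (h0 : ∀ p ∈ sphere (0 : ℂ) R, 0 < s * p.re → g p ≠ 0) :
    (∀ p ∈ sphere (0 : ℂ) R, 0 < s * p.re → 0 < g p) ∨
      ∀ p ∈ sphere (0 : ℂ) R, 0 < s * p.re → g p < 0 := by
  have hs2 : s * s = 1 := by rw [← abs_mul_abs_self, hs, one_mul]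
  set c : ℝ → ℂ := fun t => s * (R * Complex.exp (t * I)) with hc
  have cre : ∀ t, (c t).re = s * (R * Real.cos t) := by
    intro t
    simp [hc, Complex.exp_ofReal_mul_I_re, Complex.exp_ofReal_mul_I_im]
  have cmem : ∀ t, c t ∈ sphere (0 : ℂ) R := by
    intro t
    simp only [hc, mem_sphere_iff_norm, sub_zero, norm_mul, Complex.norm_real, Real.norm_eq_abs,
      hs, abs_of_pos hR, Complex.norm_exp_ofReal_mul_I, one_mul, mul_one]
  have cpos : ∀ t ∈ Set.Ioo (-(Real.pi / 2)) (Real.pi / 2), 0 < s * (c t).re := by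
    intro t ht
    rw [cre, ← mul_assoc, hs2, one_mul]
    exact mul_pos hR (Real.cos_pos_of_mem_Ioo ht)
  have csurj : ∀ p ∈ sphere (0 : ℂ) R, 0 < s * p.re →
      ∃ t ∈ Set.Ioo (-(Real.pi / 2)) (Real.pi / 2), c t = p := by
    intro p hp hpos
    refine ⟨Complex.arg (s * p), ?_, ?_⟩
    · have : |Complex.arg (s * p)| < Real.pi / 2 := by
        rw [Complex.abs_arg_lt_pi_div_two_iff]
        left
        simpa using hpos
      exact abs_lt.1 this
    · have hn : ‖(s : ℂ) * p‖ = R := by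
        rw [norm_mul, Complex.norm_real, Real.norm_eq_abs, hs, one_mul]; simpa using hp
      have := Complex.norm_mul_exp_arg_mul_I (s * p)
      rw [hn] at this
      simp only [hc, this]
      rw [← mul_assoc, ← Complex.ofReal_mul, hs2]
      simp
  have hcont : ContinuousOn (fun t => g (c t)) (Set.Ioo (-(Real.pi / 2)) (Real.pi / 2)) := by
    refine hg.comp (Continuous.continuousOn ?_) (fun t _ => cmem t)
    fun_prop
  by_contra! hcon
  obtain ⟨⟨p, hp, hp1, hp2⟩, q, hq, hq1, hq2⟩ := hcon
  obtain ⟨a, ha, rfl⟩ := csurj p hp hp1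
  obtain ⟨b, hb, rfl⟩ := csurj q hq hq1
  obtain ⟨t, ht, ht0⟩ := isPreconnected_Ioo.intermediate_value ha hb hcont ⟨hp2, hq2⟩
  exact h0 _ (cmem t) (cpos t ht) ht0

/-- `f` restricts to a homeomorphism of the unit circle onto the circle of radius `R`, with
inverse `ψ`. -/
structure CircleHomeo (R : ℝ) (f ψ : ℂ → ℂ) : Prop where
  cont : ContinuousOn ψ (sphere 0 R)
  map_inv : ∀ p ∈ sphere (0 : ℂ) R, ψ p ∈ sphere (0 : ℂ) 1
  map : ∀ w ∈ sphere (0 : ℂ) 1, f w ∈ sphere (0 : ℂ) R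
  right_inv : ∀ p ∈ sphere (0 : ℂ) R, f (ψ p) = p
  left_inv : ∀ w ∈ sphere (0 : ℂ) 1, ψ (f w) = w

/-- `P` and `Q` are the preimages of `± R I`, the only zeros of `Re f` on the unit circle. Each open
half circle of the target is connected, so its preimage lies strictly on one side of the chord. -/
theorem CircleHomeo.exists_chord {R : ℝ} (hR : 0 < R) {f ψ : ℂ → ℂ} (h : CircleHomeo R f ψ) :
    ∃ (P Q α : ℂ) (β : ℝ), ‖P‖ = 1 ∧ ‖Q‖ = 1 ∧ ‖α‖ = 1 ∧
      ∀ w : ℂ, ‖w‖ = 1 → |(conj α * w).re + β| = ‖w - P‖ * ‖w - Q‖ / 2 ∧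
        0 ≤ (f w).re * ((conj α * w).re + β) := by
  have hp : (R * I : ℂ) ∈ sphere (0 : ℂ) R := by simp [hR.le]
  have hq : (-(R * I) : ℂ) ∈ sphere (0 : ℂ) R := by simp [hR.le]
  have hP : ‖ψ (R * I)‖ = 1 := by simpa using h.map_inv _ hp
  have hQ : ‖ψ (-(R * I))‖ = 1 := by simpa using h.map_inv _ hq
  have hPQ : ψ (R * I) ≠ ψ (-(R * I)) := by
    intro he
    have := congrArg f he
    rw [h.right_inv _ hp, h.right_inv _ hq] at this
    have := congrArg Complex.im this
    simp at this
    linarith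
  obtain ⟨α, β, hα, habs, ⟨w₁, hw₁, hpos⟩, ⟨w₂, hw₂, hneg⟩⟩ := exists_chord_function hP hQ hPQ
  -- The sign `σ` records which side of the chord carries `Re f > 0`; it is absorbed into `α` and
  -- `β` at the end.
  have key : ∃ σ : ℝ, |σ| = 1 ∧ ∀ w : ℂ, ‖w‖ = 1 →
      0 ≤ σ * ((f w).re * ((conj α * w).re + β)) := by
    have hcont : ContinuousOn (fun p => (conj α * ψ p).re + β) (sphere 0 R) := by
      have := h.cont
      fun_prop
    have hne : ∀ p ∈ sphere (0 : ℂ) R, p.re ≠ 0 → (conj α * ψ p).re + β ≠ 0 := by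
      intro p hp' hre h0
      have h1 := habs (ψ p) (by simpa using h.map_inv p hp')
      rw [h0, abs_zero] at h1
      have h2 : ψ p = ψ (R * I) ∨ ψ p = ψ (-(R * I)) := by
        have : ‖ψ p - ψ (R * I)‖ * ‖ψ p - ψ (-(R * I))‖ = 0 := by linarith
        rcases mul_eq_zero.1 this with h' | h'
        · left; exact sub_eq_zero.1 (norm_eq_zero.1 h')
        · right; exact sub_eq_zero.1 (norm_eq_zero.1 h')
      apply hre
      rcases h2 with h2 | h2
      · have := congrArg f h2
        rw [h.right_inv _ hp, h.right_inv _ hp'] at this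
        simp [this]
      · have := congrArg f h2
        rw [h.right_inv _ hq, h.right_inv _ hp'] at this
        simp [this]
    have hzero : ∀ w : ℂ, ‖w‖ = 1 → (f w).re = 0 → (conj α * w).re + β = 0 := by
      intro w hw hre
      have hwS : w ∈ sphere (0 : ℂ) 1 := by simpa using hw
      have hfn : ‖f w‖ = R := by simpa using h.map w hwS
      have hfw : f w = (f w).im * I := by
        apply Complex.ext <;> simp [hre]
      have him : |(f w).im| = R := by
        rw [hfw] at hfn
        simpa using hfn
      have h1 := habs w hw
      have hl := h.left_inv w hwS
      rcases abs_eq hR.le |>.1 him with h' | h' <;> rw [h'] at hfw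
      · rw [hfw] at hl
        rw [hl] at h1
        simpa using h1
      · rw [hfw] at hl
        simp only [ofReal_neg, neg_mul] at hl
        rw [hl] at h1
        simpa using h1
    have hall : ∀ w : ℂ, ‖w‖ = 1 → f w ∈ sphere (0 : ℂ) R ∧ ψ (f w) = w := fun w hw =>
      ⟨h.map w (by simpa using hw), h.left_inv w (by simpa using hw)⟩
    have S1 := sign_const_on_half_circle hR hcont (s := 1) (by simp)
      (fun p hp' hr => hne p hp' (by rw [one_mul] at hr; exact hr.ne'))
    have S2 := sign_const_on_half_circle hR hcont (s := -1) (by simp)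
      (fun p hp' hr => hne p hp' (by intro h0; simp [h0] at hr))
    have T1 : (∀ w : ℂ, ‖w‖ = 1 → 0 < (f w).re → 0 < (conj α * w).re + β) ∨
        ∀ w : ℂ, ‖w‖ = 1 → 0 < (f w).re → (conj α * w).re + β < 0 := by
      refine S1.imp (fun H w hw hr => ?_) (fun H w hw hr => ?_) <;>
      · have := H (f w) (hall w hw).1 (by simpa using hr)
        rwa [(hall w hw).2] at this
    have T2 : (∀ w : ℂ, ‖w‖ = 1 → (f w).re < 0 → 0 < (conj α * w).re + β) ∨
        ∀ w : ℂ, ‖w‖ = 1 → (f w).re < 0 → (conj α * w).re + β < 0 := by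
      refine S2.imp (fun H w hw hr => ?_) (fun H w hw hr => ?_) <;>
      · have := H (f w) (hall w hw).1 (by simpa using hr)
        rwa [(hall w hw).2] at this
    -- Both half circles on the same side is impossible: the affine function takes both signs, at
    -- `w₁` and `w₂`.
    rcases T1 with T1 | T1 <;> rcases T2 with T2 | T2
    · exfalso
      rcases lt_trichotomy (f w₂).re 0 with h' | h' | h'
      · linarith [T2 w₂ hw₂ h']
      · linarith [hzero w₂ hw₂ h']
      · linarith [T1 w₂ hw₂ h']
    · refine ⟨1, by simp, fun w hw => ?_⟩
      rcases lt_trichotomy (f w).re 0 with h' | h' | h'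
      · rw [one_mul]; exact (mul_pos_of_neg_of_neg h' (T2 w hw h')).le
      · simp [h']
      · rw [one_mul]; exact (mul_pos h' (T1 w hw h')).le
    · refine ⟨-1, by simp, fun w hw => ?_⟩
      rcases lt_trichotomy (f w).re 0 with h' | h' | h'
      · linarith [mul_neg_of_neg_of_pos h' (T2 w hw h')]
      · simp [h']
      · linarith [mul_neg_of_pos_of_neg h' (T1 w hw h')]
    · exfalso
      rcases lt_trichotomy (f w₁).re 0 with h' | h' | h'
      · linarith [T2 w₁ hw₁ h']
      · linarith [hzero w₁ hw₁ h']
      · linarith [T1 w₁ hw₁ h']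
  obtain ⟨σ, hσ, hsgn⟩ := key
  have e : ∀ w : ℂ, (conj (σ * α) * w).re + σ * β = σ * ((conj α * w).re + β) := by
    intro w
    rw [map_mul, Complex.conj_ofReal, mul_assoc, Complex.re_ofReal_mul]; ring
  refine ⟨_, _, σ * α, σ * β, hP, hQ, ?_, fun w hw => ?_⟩
  · rw [norm_mul, Complex.norm_real, Real.norm_eq_abs, hσ, hα, one_mul]
  · rw [e, abs_mul, hσ, one_mul]
    refine ⟨habs w hw, ?_⟩
    rw [← mul_assoc, mul_comm _ σ, mul_assoc]
    exact hsgn w hw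

/-- The mean value property of the polynomial `∏ (w - P i)`, whose value at `0` has modulus `1`. -/
theorem one_le_circleAverage_prod {P : Fin 4 → ℂ} (hP : ∀ i, ‖P i‖ = 1) :
    1 ≤ Real.circleAverage (fun w => ∏ i, ‖w - P i‖) 0 1 := by
  have hd : Differentiable ℂ (fun w : ℂ => ∏ i, (w - P i)) := by fun_prop
  have hh : HarmonicOnNhd (fun w : ℂ => ∏ i, (w - P i)) (closedBall 0 |1|) := fun w _ =>
    (hd.analyticAt w).harmonicAt
  have h1 := congrArg norm hh.circleAverage_eq
  have h2 : ‖∏ i, (0 - P i)‖ = 1 := by simp [norm_prod, hP]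
  rw [h2] at h1
  have h3 : ‖(2 * Real.pi)⁻¹‖ = (2 * Real.pi)⁻¹ := by
    rw [Real.norm_eq_abs, abs_of_pos (by positivity)]
  rw [Real.circleAverage, norm_smul, h3] at h1
  refine h1.ge.trans ?_
  rw [Real.circleAverage, smul_eq_mul]
  gcongr
  refine (intervalIntegral.norm_integral_le_integral_norm (by positivity)).trans (le_of_eq ?_)
  simp [norm_prod]

/-- The constant `β` contributes `β * U 0 = 0`, which is why centre must go to centre. -/
theorem circleAverage_mul_chord {U : ℂ → ℝ} (hU : HarmonicOnNhd U (ball 0 1))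
    (hc : ContinuousOn U (closedBall 0 1)) (h0 : U 0 = 0) {α : ℂ} (hα : ‖α‖ = 1) (β : ℝ) :
    Real.circleAverage (fun w => U w * ((conj α * w).re + β)) 0 1
      ≤ (|fderiv ℝ U 0 1| + |fderiv ℝ U 0 I|) / 2 := by
  have hS : ContinuousOn U (sphere 0 |1|) := by
    rw [abs_one]; exact hc.mono sphere_subset_closedBall
  have i1 : CircleIntegrable (fun w => U w * (conj α * w).re) 0 1 :=
    ContinuousOn.circleIntegrable' (by fun_prop)
  have i2 : CircleIntegrable (fun w => β * U w) 0 1 :=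
    ContinuousOn.circleIntegrable' (by fun_prop)
  have e : (fun w => U w * ((conj α * w).re + β))
      = fun w => U w * (conj α * w).re + β * U w := by
    ext w; ring
  have m : Real.circleAverage U 0 1 = U 0 := by
    apply InnerProductSpace.HarmonicContOnCl.circleAverage_eq
    rw [abs_one]
    exact HarmonicContOnCl.mk_ball hU hc
  have m' : Real.circleAverage (fun w => β * U w) 0 1 = 0 := by
    have := Real.circleAverage_fun_smul (a := β) (f := U) (c := 0) (R := 1)
    simp only [smul_eq_mul] at this
    rw [this, m, h0, mul_zero]
  rw [e, Real.circleAverage_fun_add i1 i2, circleAverage_mul_re hU hc, m', add_zero]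
  have hlin : fderiv ℝ U 0 α = α.re * fderiv ℝ U 0 1 + α.im * fderiv ℝ U 0 I := by
    conv_lhs => rw [show α = α.re • (1 : ℂ) + α.im • I by apply Complex.ext <;> simp]
    rw [map_add, map_smul, map_smul, smul_eq_mul, smul_eq_mul]
  have a1 : |α.re| ≤ 1 := hα ▸ Complex.abs_re_le_norm α
  have a2 : |α.im| ≤ 1 := hα ▸ Complex.abs_im_le_norm α
  gcongr
  rw [hlin]
  refine (le_abs_self _).trans ((abs_add_le _ _).trans ?_)
  rw [abs_mul, abs_mul]
  have := mul_le_mul_of_nonneg_right a1 (abs_nonneg (fderiv ℝ U 0 1))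
  have := mul_le_mul_of_nonneg_right a2 (abs_nonneg (fderiv ℝ U 0 I))
  linarith

/-- **Heinz's inequality** for harmonic maps of the unit disc whose boundary values are a
homeomorphism of circles. -/
theorem CircleHomeo.heinz {R : ℝ} (hR : 0 < R) {f ψ : ℂ → ℂ} (h : CircleHomeo R f ψ)
    (hc : ContinuousOn f (closedBall 0 1)) (h0 : f 0 = 0)
    (hre : HarmonicOnNhd (fun w => (f w).re) (ball 0 1))
    (him : HarmonicOnNhd (fun w => (f w).im) (ball 0 1)) :
    R / 4 ≤ |fderiv ℝ (fun w => (f w).re) 0 1| + |fderiv ℝ (fun w => (f w).re) 0 I|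
      + (|fderiv ℝ (fun w => (f w).im) 0 1| + |fderiv ℝ (fun w => (f w).im) 0 I|) := by
  -- A quarter turn of the target makes `Im f` the real part.
  have h' : CircleHomeo R (fun w => -I * f w) (fun p => ψ (I * p)) := by
    have hmem : ∀ p ∈ sphere (0 : ℂ) R, I * p ∈ sphere (0 : ℂ) R := fun p hp => by simpa using hp
    refine ⟨h.cont.comp (by fun_prop) hmem, fun p hp => h.map_inv _ (hmem p hp), fun w hw => ?_,
      fun p hp => ?_, fun w hw => ?_⟩
    · simpa using h.map w hw
    · simp only [h.right_inv _ (hmem p hp)]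
      rw [← mul_assoc]; simp
    · rw [← mul_assoc]
      simpa using h.left_inv w hw
  obtain ⟨P₁, Q₁, α₁, β₁, hP₁, hQ₁, hα₁, H₁⟩ := h.exists_chord hR
  obtain ⟨P₂, Q₂, α₂, β₂, hP₂, hQ₂, hα₂, H₂⟩ := h'.exists_chord hR
  have hrec : ContinuousOn (fun w => (f w).re) (closedBall 0 1) := by fun_prop
  have himc : ContinuousOn (fun w => (f w).im) (closedBall 0 1) := by fun_prop
  have A₁ := circleAverage_mul_chord hre hrec (by simp [h0]) hα₁ β₁
  have A₂ := circleAverage_mul_chord him himc (by simp [h0]) hα₂ β₂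
  have B := one_le_circleAverage_prod (P := ![P₁, Q₁, P₂, Q₂])
    (by intro i; fin_cases i <;> simp [*])
  have hcS : ContinuousOn f (sphere 0 |1|) := by
    rw [abs_one]; exact hc.mono sphere_subset_closedBall
  have i1 : CircleIntegrable (fun w => (f w).re * ((conj α₁ * w).re + β₁)) 0 1 :=
    ContinuousOn.circleIntegrable' (by fun_prop)
  have i2 : CircleIntegrable (fun w => (f w).im * ((conj α₂ * w).re + β₂)) 0 1 :=
    ContinuousOn.circleIntegrable' (by fun_prop)
  have i3 : CircleIntegrable (fun w => R / 8 * ∏ i, ‖w - ![P₁, Q₁, P₂, Q₂] i‖) 0 1 :=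
    ContinuousOn.circleIntegrable' (by fun_prop)
  -- Pointwise, `|l₁|, |l₂| ≤ 2` and `|Re f| + |Im f| ≥ R` give `|Re f| |l₁| + |Im f| |l₂| ≥ (R / 2)
  -- |l₁| |l₂|`.
  have C := Real.circleAverage_mono i3 (i1.add i2) (fun w hw => by
    have hw1 : ‖w‖ = 1 := by simpa using hw
    have hfw : ‖f w‖ = R := by simpa using h.map w (by simpa using hw1)
    obtain ⟨a1, b1⟩ := H₁ w hw1
    obtain ⟨a2, b2⟩ := H₂ w hw1
    have hIre : (-I * f w).re = (f w).im := by simp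
    rw [hIre] at b2
    have n2 : ∀ p : ℂ, ‖p‖ = 1 → ‖w - p‖ ≤ 2 := fun p hp =>
      (norm_sub_le _ _).trans (by rw [hw1, hp]; norm_num)
    set l₁ := (conj α₁ * w).re + β₁
    set l₂ := (conj α₂ * w).re + β₂
    have l1 : |l₁| ≤ 2 := by
      rw [a1]
      have := mul_le_mul (n2 _ hP₁) (n2 _ hQ₁) (norm_nonneg _) (by norm_num)
      linarith
    have l2 : |l₂| ≤ 2 := by
      rw [a2]
      have := mul_le_mul (n2 _ hP₂) (n2 _ hQ₂) (norm_nonneg _) (by norm_num)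
      linarith
    have hsum : R ≤ |(f w).re| + |(f w).im| := hfw ▸ Complex.norm_le_abs_re_add_abs_im _
    have e : R / 8 * ∏ i, ‖w - ![P₁, Q₁, P₂, Q₂] i‖ = R / 2 * (|l₁| * |l₂|) := by
      rw [a1, a2]
      simp [Fin.prod_univ_four]
      ring
    simp only [Pi.add_apply]
    rw [e, ← abs_of_nonneg b1, ← abs_of_nonneg b2, abs_mul, abs_mul]
    have p1 := abs_nonneg l₁
    have p2 := abs_nonneg l₂
    have t1 := mul_nonneg (mul_nonneg (abs_nonneg (f w).re) p1) (sub_nonneg.2 l2)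
    have t2 := mul_nonneg (mul_nonneg (abs_nonneg (f w).im) p2) (sub_nonneg.2 l1)
    have t3 := mul_nonneg (mul_nonneg p1 p2) (sub_nonneg.2 hsum)
    nlinarith)
  rw [Real.circleAverage_add i1 i2] at C
  have D : Real.circleAverage (fun w => R / 8 * ∏ i, ‖w - ![P₁, Q₁, P₂, Q₂] i‖) 0 1
      = R / 8 * Real.circleAverage (fun w => ∏ i, ‖w - ![P₁, Q₁, P₂, Q₂] i‖) 0 1 := by
    have := Real.circleAverage_fun_smul (a := R / 8)
      (f := fun w => ∏ i, ‖w - ![P₁, Q₁, P₂, Q₂] i‖) (c := 0) (R := 1)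
    simpa only [smul_eq_mul] using this
  rw [D] at C
  have E := mul_le_mul_of_nonneg_left B (show 0 ≤ R / 8 by positivity)
  linarith

end

/-! ### Boundary behaviour of homeomorphisms of discs -/

section

open Metric InnerProductSpace Complex ComplexConjugate

/-- If `P` were missed, `-ψ / P` would avoid `-1` and have a continuous argument on the circle. A
continuous real function on a circle agrees at some pair of antipodal points, against injectivity.
-/
theorem surjOn_sphere_of_injOn {R : ℝ} (hR : 0 < R) {ψ : ℂ → ℂ}
    (hψ : ContinuousOn ψ (sphere 0 R)) (hm : Set.MapsTo ψ (sphere 0 R) (sphere 0 1))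
    (hi : Set.InjOn ψ (sphere 0 R)) : Set.SurjOn ψ (sphere 0 R) (sphere 0 1) := by
  intro P hP
  by_contra hn
  have hP1 : ‖P‖ = 1 := by simpa using hP
  have hP0 : P ≠ 0 := by rintro rfl; simp at hP1
  have hnorm : ∀ p ∈ sphere (0 : ℂ) R, ‖-ψ p / P‖ = 1 := by
    intro p hp
    have : ‖ψ p‖ = 1 := by simpa using hm hp
    simp [this, hP1]
  have hslit : ∀ p ∈ sphere (0 : ℂ) R, -ψ p / P ∈ slitPlane := by
    intro p hp
    by_contra hs
    rw [mem_slitPlane_iff] at hs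
    push Not at hs
    have h1 := hnorm p hp
    have h2 : -ψ p / P = ((-ψ p / P).re : ℂ) := by apply Complex.ext <;> simp [hs.2]
    rw [h2, Complex.norm_real, Real.norm_eq_abs, abs_of_nonpos hs.1] at h1
    have h3 : -ψ p / P = -1 := by
      rw [h2, show (-ψ p / P).re = -1 by linarith]; simp
    apply hn
    refine ⟨p, hp, ?_⟩
    field_simp at h3
    simpa using h3
  have hneg : ∀ p ∈ sphere (0 : ℂ) R, -p ∈ sphere (0 : ℂ) R := fun p hp => by simpa using hp
  set η : ℂ → ℝ := fun p => arg (-ψ p / P) with hη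
  have hηc : ContinuousOn η (sphere 0 R) := by
    intro p hp
    exact (continuousAt_arg (hslit p hp)).comp_continuousWithinAt
      (f := fun p => -ψ p / P) (((hψ p hp).neg).div_const P)
  have hηc' : ContinuousOn (fun p => η (-p)) (sphere 0 R) :=
    hηc.comp (by fun_prop) hneg
  have hpre : IsPreconnected (sphere (0 : ℂ) R) :=
    isPreconnected_sphere (by simp [Complex.rank_real_complex]) 0 R
  have hRm : (R : ℂ) ∈ sphere (0 : ℂ) R := by simp [hR.le]
  obtain ⟨t, ht, hte⟩ : ∃ t ∈ sphere (0 : ℂ) R, η t = η (-t) := by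
    rcases le_total (η R) (η (-R)) with h | h
    · exact hpre.intermediate_value₂ hRm (hneg _ hRm) hηc hηc' h (by simpa using h)
    · exact hpre.intermediate_value₂ (hneg _ hRm) hRm hηc hηc' (by simpa using h) h
  have h1 : -ψ t / P = -ψ (-t) / P :=
    Complex.ext_norm_arg (by rw [hnorm t ht, hnorm _ (hneg t ht)]) hte
  have h2 : ψ t = ψ (-t) := by
    field_simp at h1
    simpa using h1
  have h3 := hi ht (hneg t ht) h2
  have h4 : t = 0 := self_eq_neg.1 h3
  rw [h4] at ht
  simp at ht
  linarith

theorem continuousOn_invFunOn_of_isCompact {α β : Type*} [TopologicalSpace α] [Nonempty α]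
    [TopologicalSpace β] [T2Space β] {f : α → β} {s : Set α} {t : Set β} (hs : IsCompact s)
    (hf : ContinuousOn f s) (h : Set.BijOn f s t) : ContinuousOn (Function.invFunOn f s) t := by
  rw [continuousOn_iff_isClosed]
  intro u hu
  refine ⟨f '' (s ∩ u), ((hs.inter_right hu).image_of_continuousOn
    (hf.mono Set.inter_subset_left)).isClosed, ?_⟩
  have hinv := h.invOn_invFunOn
  ext y
  constructor
  · rintro ⟨hy, hyt⟩
    exact ⟨⟨_, ⟨h.surjOn.mapsTo_invFunOn hyt, hy⟩, hinv.2 hyt⟩, hyt⟩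
  · rintro ⟨⟨x, ⟨hx, hxu⟩, rfl⟩, hyt⟩
    refine ⟨?_, hyt⟩
    rw [Set.mem_preimage, hinv.1 hx]
    exact hxu

/-- Since `f` sends interior to interior, the inverse sends boundary into boundary; that `f` also
does so is the surjectivity of this injective map of circles. -/
theorem exists_circleHomeo {R : ℝ} (hR : 0 < R) {f : ℂ → ℂ}
    (hf : ContinuousOn f (closedBall 0 1)) (hbij : Set.BijOn f (closedBall 0 1) (closedBall 0 R))
    (hball : Set.MapsTo f (ball 0 1) (ball 0 R)) : ∃ ψ, CircleHomeo R f ψ := by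
  have hinv := hbij.invOn_invFunOn
  have hc := continuousOn_invFunOn_of_isCompact (isCompact_closedBall 0 1) hf hbij
  set ψ := Function.invFunOn f (closedBall 0 1)
  have hsub : sphere (0 : ℂ) R ⊆ closedBall 0 R := sphere_subset_closedBall
  have hmaps : Set.MapsTo ψ (sphere 0 R) (sphere 0 1) := by
    intro p hp
    have h1 : ψ p ∈ closedBall (0 : ℂ) 1 := hbij.surjOn.mapsTo_invFunOn (hsub hp)
    by_contra hcon
    have h2 : ψ p ∈ ball (0 : ℂ) 1 := by
      rw [mem_closedBall] at h1
      rw [mem_sphere] at hcon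
      exact mem_ball.2 (lt_of_le_of_ne h1 hcon)
    have h3 := hball h2
    rw [hinv.2 (hsub hp), mem_ball] at h3
    rw [mem_sphere] at hp
    linarith
  have hsurj := surjOn_sphere_of_injOn hR (hc.mono hsub) hmaps (hinv.2.mono hsub).injOn
  refine ⟨ψ, hc.mono hsub, hmaps, fun w hw => ?_, fun p hp => hinv.2 (hsub hp), fun w hw =>
    hinv.1 (sphere_subset_closedBall hw)⟩
  obtain ⟨p, hp, rfl⟩ := hsurj hw
  rwa [hinv.2 (hsub hp)]

end

/-! ### Second-order chain rule and the Laplacian in conformal parameters -/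

section

open Metric

section SecondDerivative

variable {F : Type*} [NormedAddCommGroup F] [NormedSpace ℝ F]

theorem eq_smul_add_smul (v : E 2) :
    v = v 0 • EuclideanSpace.single 0 (1 : ℝ) + v 1 • EuclideanSpace.single 1 (1 : ℝ) := by
  ext i; fin_cases i <;> simp

theorem fderiv_apply_eq (f : E 2 → F) (w v : E 2) :
    fderiv ℝ f w v = v 0 • pd 0 f w + v 1 • pd 1 f w := by
  conv_lhs => rw [eq_smul_add_smul v]
  rw [map_add, map_smul, map_smul]
  rfl

theorem pd_comp {G : E 2 → F} {z : E 2 → E 2} {w : E 2} (hG : DifferentiableAt ℝ G (z w))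
    (hz : DifferentiableAt ℝ z w) (i : Fin 2) :
    pd i (G ∘ z) w = pd i z w 0 • pd 0 G (z w) + pd i z w 1 • pd 1 G (z w) := by
  rw [← fderiv_apply_eq]
  simp only [pd]
  rw [fderiv_comp w hG hz]
  rfl

theorem pd_pd_eq {f : E 2 → F} {w : E 2} (hf : ContDiffAt ℝ 2 f w) (i j : Fin 2) :
    pd j (pd i f) w = fderiv ℝ (fderiv ℝ f) w (EuclideanSpace.single j 1)
      (EuclideanSpace.single i 1) := by
  have hd : DifferentiableAt ℝ (fderiv ℝ f) w :=
    (hf.fderiv_right (m := 1) le_rfl).differentiableAt one_ne_zero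
  have := (hd.hasFDerivAt.clm_apply (hasFDerivAt_const (EuclideanSpace.single i (1 : ℝ)) w)).fderiv
  change fderiv ℝ (fun y => fderiv ℝ f y (EuclideanSpace.single i 1)) w _ = _
  rw [this]
  simp

theorem pd_pd_comm {f : E 2 → F} {w : E 2} (hf : ContDiffAt ℝ 2 f w) (i j : Fin 2) :
    pd j (pd i f) w = pd i (pd j f) w := by
  rw [pd_pd_eq hf, pd_pd_eq hf]
  exact (hf.isSymmSndFDerivAt (by simp)).eq _ _

theorem differentiableAt_pd {f : E 2 → F} {w : E 2} (hf : ContDiffAt ℝ 2 f w) (i : Fin 2) :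
    DifferentiableAt ℝ (pd i f) w :=
  ((hf.fderiv_right (m := 1) le_rfl).differentiableAt one_ne_zero).clm_apply
    (differentiableAt_const _)

theorem pd_inner {V : Type*} [NormedAddCommGroup V] [InnerProductSpace ℝ V] {f g : E 2 → V}
    {w : E 2} (hf : DifferentiableAt ℝ f w) (hg : DifferentiableAt ℝ g w) (i : Fin 2) :
    pd i (fun y => inner ℝ (f y) (g y)) w = inner ℝ (f w) (pd i g w) + inner ℝ (pd i f w) (g w) :=
  fderiv_inner_apply ℝ hf hg _

theorem fderiv_fderiv_comp {V : Type*} [NormedAddCommGroup V] [NormedSpace ℝ V] {G : V → F}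
    {z : E 2 → V} {w : E 2} (hG : ContDiffAt ℝ 2 G (z w)) (hz : ContDiffAt ℝ 2 z w)
    (u v : E 2) :
    fderiv ℝ (fderiv ℝ (G ∘ z)) w u v = fderiv ℝ (fderiv ℝ G) (z w) (fderiv ℝ z w u) (fderiv ℝ z w v)
      + fderiv ℝ G (z w) (fderiv ℝ (fderiv ℝ z) w u v) := by
  have hG' : DifferentiableAt ℝ (fderiv ℝ G) (z w) :=
    (hG.fderiv_right (m := 1) le_rfl).differentiableAt one_ne_zero
  have hz' : DifferentiableAt ℝ (fderiv ℝ z) w :=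
    (hz.fderiv_right (m := 1) le_rfl).differentiableAt one_ne_zero
  have hzd : DifferentiableAt ℝ z w := hz.differentiableAt two_ne_zero
  have h1 : fderiv ℝ (G ∘ z) =ᶠ[nhds w] fun y => (fderiv ℝ G (z y)).comp (fderiv ℝ z y) := by
    filter_upwards [hz.eventually (by simp), hz.continuousAt.eventually (hG.eventually (by simp))]
      with y hy hGy
    exact fderiv_comp y (hGy.differentiableAt two_ne_zero) (hy.differentiableAt two_ne_zero)
  rw [h1.fderiv_eq]
  have h2 := (hG'.hasFDerivAt.comp w hzd.hasFDerivAt).clm_comp hz'.hasFDerivAt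
  have h3 := h2.fderiv
  simp only [Function.comp_def] at h3
  rw [h3]
  simp [add_comm]

end SecondDerivative

/-- With `J` the matrix of rows `(a, b)` and `(c, d)`, the hypotheses say `J g Jᵀ = W`, hence `Jᵀ J
= W g⁻¹`. The conclusion is the trace of `l` against `Jᵀ J`, so it is a multiple of the trace
against `g⁻¹`, the mean curvature. -/
theorem sum_mul_eq_zero_of_isothermal {a b c d g₀₀ g₀₁ g₁₁ l₀₀ l₀₁ l₁₁ W : ℝ} (hW : 0 < W)
    (h₀₀ : g₀₀ * a ^ 2 + 2 * g₀₁ * (a * b) + g₁₁ * b ^ 2 = W)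
    (h₁₁ : g₀₀ * c ^ 2 + 2 * g₀₁ * (c * d) + g₁₁ * d ^ 2 = W)
    (h₀₁ : g₀₀ * (a * c) + g₀₁ * (a * d + b * c) + g₁₁ * (b * d) = 0)
    (hl : g₁₁ * l₀₀ - 2 * g₀₁ * l₀₁ + g₀₀ * l₁₁ = 0) :
    l₀₀ * (a ^ 2 + c ^ 2) + 2 * l₀₁ * (a * b + c * d) + l₁₁ * (b ^ 2 + d ^ 2) = 0 := by
  have hdet : (g₀₀ * g₁₁ - g₀₁ ^ 2) * (a * d - b * c) ^ 2 = W ^ 2 := by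
    linear_combination h₀₀ * (g₀₀ * c ^ 2 + 2 * g₀₁ * (c * d) + g₁₁ * d ^ 2) + W * h₁₁ -
      h₀₁ * (g₀₀ * (a * c) + g₀₁ * (a * d + b * c) + g₁₁ * (b * d))
  have hΔ : g₀₀ * g₁₁ - g₀₁ ^ 2 ≠ 0 := by
    intro h; rw [h] at hdet; nlinarith [pow_pos hW 2]
  have m : !![(g₀₀ * a + g₀₁ * b) / W, (g₀₁ * a + g₁₁ * b) / W;
      (g₀₀ * c + g₀₁ * d) / W, (g₀₁ * c + g₁₁ * d) / W] * !![a, c; b, d] = 1 := by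
    ext i j
    fin_cases i <;> fin_cases j <;> simp [Matrix.mul_apply, Fin.sum_univ_two] <;> field_simp <;>
      linarith
  have m' := mul_eq_one_comm.1 m
  have e₀₀ := congrFun (congrFun m' 0) 0
  have e₀₁ := congrFun (congrFun m' 0) 1
  have e₁₀ := congrFun (congrFun m' 1) 0
  have e₁₁ := congrFun (congrFun m' 1) 1
  simp [Matrix.mul_apply, Fin.sum_univ_two] at e₀₀ e₀₁ e₁₀ e₁₁
  field_simp at e₀₀ e₀₁ e₁₀ e₁₁
  apply mul_left_cancel₀ hΔ
  linear_combination W * hl + l₀₀ * (g₁₁ * e₀₀ - g₀₁ * e₀₁) + 2 * l₀₁ * (g₀₀ * e₀₁ - g₀₁ * e₀₀)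
    + l₁₁ * (g₀₀ * e₁₁ - g₀₁ * e₁₀)

section Surface

variable {n : ℕ}

theorem areaElement_sq_pos {X : E 2 → E n} {w : E 2} (h : 0 < areaElement X w) :
    0 < firstForm X 0 0 w * firstForm X 1 1 w - firstForm X 0 1 w ^ 2 := Real.sqrt_pos.1 h

theorem firstForm_comm (X : E 2 → E n) (i j : Fin 2) (w : E 2) :
    firstForm X i j w = firstForm X j i w := real_inner_comm _ _

theorem firstForm_comp {G : E 2 → E n} {z : E 2 → E 2} {w : E 2}
    (hG : DifferentiableAt ℝ G (z w)) (hz : DifferentiableAt ℝ z w) (i j : Fin 2) :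
    firstForm (G ∘ z) i j w = firstForm G 0 0 (z w) * (pd i z w 0 * pd j z w 0)
      + firstForm G 0 1 (z w) * (pd i z w 0 * pd j z w 1 + pd i z w 1 * pd j z w 0)
      + firstForm G 1 1 (z w) * (pd i z w 1 * pd j z w 1) := by
  have h := pd_comp hG hz
  simp only [firstForm, h, inner_add_left, inner_add_right, real_inner_smul_left,
    real_inner_smul_right]
  rw [real_inner_comm (pd 0 G (z w)) (pd 1 G (z w))]
  ring

/-- In conformal parameters `X_{uu} + X_{vv}` has no component along a normal of vanishing mean
curvature. -/
theorem inner_laplace_normal_eq_zero {G : E 2 → E n} {z : E 2 → E 2} {w : E 2}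
    (hG : ContDiffAt ℝ 2 G (z w)) (hz : ContDiffAt ℝ 2 z w)
    (hconf : IsConformalImmersionOn (G ∘ z) {w}) {ν : E n} (hν : IsUnitNormalAt G ν (z w))
    (hH : meanCurvature G ν (z w) = 0) :
    inner ℝ (pd 0 (pd 0 (G ∘ z)) w + pd 1 (pd 1 (G ∘ z)) w) ν = 0 := by
  obtain ⟨hW, h₀₀, h₁₁, h₀₁⟩ := hconf w rfl
  have hdet := areaElement_sq_pos hW
  have hGd := hG.differentiableAt two_ne_zero
  have hzd := hz.differentiableAt two_ne_zero
  set W := areaElement (G ∘ z) w with hWdef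
  have hX := hG.comp w hz
  have hsym := pd_pd_comm hG 0 1
  rw [firstForm_comp hGd hzd] at h₀₀ h₁₁ h₀₁
  rw [firstForm_comp hGd hzd, firstForm_comp hGd hzd, firstForm_comp hGd hzd] at hdet
  have hΔ : 0 < firstForm G 0 0 (z w) * firstForm G 1 1 (z w) - firstForm G 0 1 (z w) ^ 2 := by
    by_contra! hcon
    have := mul_nonneg (sub_nonneg.2 hcon)
      (sq_nonneg (pd 0 z w 0 * pd 1 z w 1 - pd 0 z w 1 * pd 1 z w 0))
    nlinarith
  have hl : firstForm G 1 1 (z w) * secondForm G ν 0 0 (z w)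
      - 2 * firstForm G 0 1 (z w) * secondForm G ν 0 1 (z w)
      + firstForm G 0 0 (z w) * secondForm G ν 1 1 (z w) = 0 := by
    have hA : areaElement G (z w) ≠ 0 := (Real.sqrt_pos.2 hΔ).ne'
    rw [meanCurvature, div_eq_zero_iff] at hH
    exact hH.resolve_right (by positivity)
  have key := sum_mul_eq_zero_of_isothermal (a := pd 0 z w 0) (b := pd 0 z w 1)
    (c := pd 1 z w 0) (d := pd 1 z w 1) hW (by linarith) (by linarith) (by linarith) hl
  have hex : ∀ k, inner ℝ (pd k (pd k (G ∘ z)) w) ν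
      = secondForm G ν 0 0 (z w) * pd k z w 0 ^ 2
        + 2 * secondForm G ν 0 1 (z w) * (pd k z w 0 * pd k z w 1)
        + secondForm G ν 1 1 (z w) * pd k z w 1 ^ 2 := by
    intro k
    have hk : fderiv ℝ z w (EuclideanSpace.single k 1) = pd k z w := rfl
    rw [pd_pd_eq hX, fderiv_fderiv_comp hG hz, hk, fderiv_apply_eq G, eq_smul_add_smul (pd k z w)]
    simp only [map_add, map_smul, add_apply, smul_apply]
    rw [← pd_pd_eq hG, ← pd_pd_eq hG, ← pd_pd_eq hG, ← pd_pd_eq hG, ← hsym, ← eq_smul_add_smul]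
    -- The terms with second derivatives of `z` are tangential and disappear against `ν`.
    simp only [smul_add, inner_add_left, real_inner_smul_left, hν.2, secondForm]
    ring
  rw [inner_add_left, hex, hex]
  linarith

/-- In conformal parameters `X_{uu} + X_{vv}` is orthogonal to the tangent plane. -/
theorem inner_laplace_tangent_eq_zero {X : E 2 → E n} {s : Set (E 2)} (hs : IsOpen s)
    (hX : ContDiffOn ℝ 2 X s) (hconf : IsConformalImmersionOn X s) {w : E 2} (hw : w ∈ s)
    (i : Fin 2) : inner ℝ (pd 0 (pd 0 X) w + pd 1 (pd 1 X) w) (pd i X w) = 0 := by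
  have hXw := hX.contDiffAt (hs.mem_nhds hw)
  have hd := differentiableAt_pd hXw
  have e1 : (fun y => inner ℝ (pd 0 X y) (pd 0 X y))
      =ᶠ[nhds w] fun y => inner ℝ (pd 1 X y) (pd 1 X y) := by
    filter_upwards [hs.mem_nhds hw] with y hy
    obtain ⟨_, h1, h2, _⟩ := hconf y hy
    exact h1.trans h2.symm
  have e2 : (fun y => inner ℝ (pd 0 X y) (pd 1 X y)) =ᶠ[nhds w] fun _ => (0 : ℝ) := by
    filter_upwards [hs.mem_nhds hw] with y hy
    exact (hconf y hy).2.2.2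
  have d1 : ∀ k, pd k (fun y => inner ℝ (pd 0 X y) (pd 0 X y)) w
      = pd k (fun y => inner ℝ (pd 1 X y) (pd 1 X y)) w := fun k => by
    simp only [pd] at e1 ⊢
    rw [e1.fderiv_eq]
  have d2 : ∀ k, pd k (fun y => inner ℝ (pd 0 X y) (pd 1 X y)) w = 0 := fun k => by
    simp only [pd] at e2 ⊢
    rw [e2.fderiv_eq]
    simp
  simp only [pd_inner (hd _) (hd _)] at d1 d2
  have hsym := pd_pd_comm hXw 0 1
  have a0 := d1 0
  have a1 := d1 1
  have b0 := d2 0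
  have b1 := d2 1
  rw [inner_add_left]
  fin_cases i
  · simp only [Fin.zero_eta]
    rw [real_inner_comm] at a0 a1 b0 b1
    rw [hsym] at *
    rw [real_inner_comm (pd 0 X w) (pd 1 (pd 1 X) w)] at *
    rw [real_inner_comm (pd 1 X w) (pd 0 (pd 1 X) w)] at *
    linarith
  · simp only [Fin.mk_one]
    rw [hsym] at *
    rw [real_inner_comm (pd 1 X w) (pd 1 (pd 1 X) w)] at *
    rw [real_inner_comm (pd 0 X w) (pd 0 (pd 1 X) w)] at *
    linarith

end Surface

end

/-! ### Graphs, transfer to the complex plane, and harmonicity -/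

section

open Metric InnerProductSpace

section Graph

variable {m : ℕ} {R : ℝ} {φ : Fin m → E 2 → ℝ}

theorem contDiffOn_graph {s : Set (E 2)} {k : WithTop ℕ∞} (h : ∀ i, ContDiffOn ℝ k (φ i) s) :
    ContDiffOn ℝ k (graph φ) s := by
  rw [contDiffOn_euclidean]
  intro i
  refine Fin.cases ?_ (fun i => Fin.cases ?_ (fun i => ?_) i) i
  · have : ContDiff ℝ k (fun p : E 2 => p 0) := by fun_prop
    exact this.contDiffOn
  · have : ContDiff ℝ k (fun p : E 2 => p 1) := by fun_prop
    exact this.contDiffOn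
  · exact h i

theorem graph_zero (φ : Fin m → E 2 → ℝ) (p : E 2) : graph φ p 0 = p 0 := rfl

theorem graph_one (φ : Fin m → E 2 → ℝ) (p : E 2) : graph φ p 1 = p 1 := rfl

theorem sq_add_sq_le_norm_sq (v : E (m + 2)) : v 0 ^ 2 + v 1 ^ 2 ≤ ‖v‖ ^ 2 := by
  rw [EuclideanSpace.real_norm_sq_eq, Fin.sum_univ_succ, Fin.sum_univ_succ, ← add_assoc]
  exact le_add_of_nonneg_right (Finset.sum_nonneg fun i _ => sq_nonneg _)

theorem norm_graph_le (h : ∀ i, ContinuousOn (φ i) (closedBall 0 R)) {p : E 2}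
    (hp : p ∈ closedBall (0 : E 2) R) : ‖graph φ p‖ ≤ graphSupNorm R φ := by
  have hc : ContinuousOn (graph φ) (closedBall 0 R) :=
    (contDiffOn_graph (k := 0) fun i => contDiffOn_zero.2 (h i)).continuousOn
  exact le_csSup ((isCompact_closedBall 0 R).bddAbove_image hc.norm) (Set.mem_image_of_mem _ hp)

/-- Supplies the strict positivity of the bound that Borel–Carathéodory asks for. -/
theorem le_graphSupNorm (hR : 0 ≤ R) (h : ∀ i, ContinuousOn (φ i) (closedBall 0 R)) :
    R ≤ graphSupNorm R φ := by
  refine le_trans ?_ (norm_graph_le h (p := EuclideanSpace.single 0 R) (by simp [abs_of_nonneg hR]))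
  have := sq_add_sq_le_norm_sq (graph φ (EuclideanSpace.single 0 R))
  rw [graph_zero, graph_one] at this
  simp at this
  exact (pow_le_pow_iff_left₀ hR (norm_nonneg _) two_ne_zero).1 this

end Graph

section Calculus

variable {F : Type*} [NormedAddCommGroup F] [NormedSpace ℝ F]

theorem pd_eqOn {f g : E 2 → F} {s : Set (E 2)} (hs : IsOpen s) (h : Set.EqOn f g s) (i : Fin 2) :
    Set.EqOn (pd i f) (pd i g) s := fun w hw => by
  have : f =ᶠ[nhds w] g := Filter.eventuallyEq_of_mem (hs.mem_nhds hw) h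
  rw [pd, pd, this.fderiv_eq]

theorem pd_inner_const {V : Type*} [NormedAddCommGroup V] [InnerProductSpace ℝ V] {f : E 2 → V}
    {w : E 2} (hf : DifferentiableAt ℝ f w) (ν : V) (i : Fin 2) :
    pd i (fun y => inner ℝ (f y) ν) w = inner ℝ (pd i f w) ν := by
  rw [pd_inner hf (differentiableAt_const ν)]
  simp [pd]

theorem pd_pd_inner_const {V : Type*} [NormedAddCommGroup V] [InnerProductSpace ℝ V] {f : E 2 → V}
    {s : Set (E 2)} (hs : IsOpen s) (hf : ContDiffOn ℝ 2 f s) (ν : V) (i j : Fin 2) {w : E 2}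
    (hw : w ∈ s) : pd j (pd i fun y => inner ℝ (f y) ν) w = inner ℝ (pd j (pd i f) w) ν := by
  have hfw : ∀ y ∈ s, ContDiffAt ℝ 2 f y := fun y hy => hf.contDiffAt (hs.mem_nhds hy)
  rw [pd_eqOn hs (fun y hy => pd_inner_const ((hfw y hy).differentiableAt two_ne_zero) ν i) j hw,
    pd_inner_const (differentiableAt_pd (hfw w hw) i)]

/-- The isometry of `ℂ` with the Euclidean plane. -/
noncomputable def plane : ℂ ≃ₗᵢ[ℝ] E 2 := Complex.orthonormalBasisOneI.repr

theorem plane_one : plane 1 = EuclideanSpace.single 0 1 := by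
  simpa using! Complex.orthonormalBasisOneI.repr_self 0

theorem plane_I : plane Complex.I = EuclideanSpace.single 1 1 := by
  simpa using! Complex.orthonormalBasisOneI.repr_self 1

theorem fderiv_comp_plane (f : E 2 → F) (ζ v : ℂ) :
    fderiv ℝ (fun ξ => f (plane ξ)) ζ v = fderiv ℝ f (plane ζ) (plane v) := by
  have := plane.toContinuousLinearEquiv.comp_right_fderiv (f := f) (x := ζ)
  exact congrArg (fun L : ℂ →L[ℝ] F => L v) this

theorem fderiv_comp_plane_one (f : E 2 → F) (ζ : ℂ) :
    fderiv ℝ (fun ξ => f (plane ξ)) ζ 1 = pd 0 f (plane ζ) := by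
  rw [fderiv_comp_plane, plane_one, pd]

theorem fderiv_comp_plane_I (f : E 2 → F) (ζ : ℂ) :
    fderiv ℝ (fun ξ => f (plane ξ)) ζ Complex.I = pd 1 f (plane ζ) := by
  rw [fderiv_comp_plane, plane_I, pd]

theorem plane_mem_ball {ζ : ℂ} {r : ℝ} : plane ζ ∈ ball (0 : E 2) r ↔ ζ ∈ ball (0 : ℂ) r := by
  simp

theorem plane_mem_closedBall {ζ : ℂ} {r : ℝ} :
    plane ζ ∈ closedBall (0 : E 2) r ↔ ζ ∈ closedBall (0 : ℂ) r := by
  simp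

theorem harmonicOnNhd_comp_plane {u : E 2 → ℝ} {r : ℝ} (hu : ContDiffOn ℝ 2 u (ball 0 r))
    (h : ∀ w ∈ ball (0 : E 2) r, pd 0 (pd 0 u) w + pd 1 (pd 1 u) w = 0) :
    HarmonicOnNhd (fun ζ => u (plane ζ)) (ball 0 r) := by
  have hc : ∀ ζ ∈ ball (0 : ℂ) r, ContDiffAt ℝ 2 (fun ζ => u (plane ζ)) ζ := fun ζ hζ =>
    (hu.contDiffAt (isOpen_ball.mem_nhds (plane_mem_ball.2 hζ))).comp ζ
      plane.contDiff.contDiffAt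
  intro ζ hζ
  refine ⟨hc ζ hζ, ?_⟩
  filter_upwards [isOpen_ball.mem_nhds hζ] with ξ hξ
  have hd : DifferentiableAt ℝ (fderiv ℝ fun ζ => u (plane ζ)) ξ :=
    ((hc ξ hξ).fderiv_right (m := 1) le_rfl).differentiableAt one_ne_zero
  have e : ∀ v, fderiv ℝ (fderiv ℝ fun ζ => u (plane ζ)) ξ v v
      = fderiv ℝ (fun y => fderiv ℝ (fun ζ => u (plane ζ)) y v) ξ v := fun v => by
    rw [(hd.hasFDerivAt.clm_apply (hasFDerivAt_const v ξ)).fderiv]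
    simp
  rw [laplacian_eq_iteratedFDeriv_complexPlane]
  simp only [iteratedFDeriv_two_apply, Matrix.cons_val_zero, Matrix.cons_val_one, Pi.zero_apply]
  rw [e, e]
  simp only [fderiv_comp_plane_one, fderiv_comp_plane_I]
  exact h _ (plane_mem_ball.2 hξ)

end Calculus

section Conformal

variable {n : ℕ}

theorem isUnitNormalAt_of_comp {G : E 2 → E n} {z : E 2 → E 2} {w : E 2}
    (hG : DifferentiableAt ℝ G (z w)) (hz : DifferentiableAt ℝ z w)
    (hW : 0 < areaElement (G ∘ z) w) {ν : E n} (hν : IsUnitNormalAt (G ∘ z) ν w) :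
    IsUnitNormalAt G ν (z w) := by
  have h := pd_comp hG hz
  have hdet := areaElement_sq_pos hW
  rw [firstForm_comp hG hz, firstForm_comp hG hz, firstForm_comp hG hz] at hdet
  have hD : pd 0 z w 0 * pd 1 z w 1 - pd 0 z w 1 * pd 1 z w 0 ≠ 0 := by
    intro h0
    have : 0 < (firstForm G 0 0 (z w) * firstForm G 1 1 (z w) - firstForm G 0 1 (z w) ^ 2)
        * (pd 0 z w 0 * pd 1 z w 1 - pd 0 z w 1 * pd 1 z w 0) ^ 2 := by
      refine hdet.trans_eq ?_
      ring
    rw [h0] at this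
    simp at this
  refine ⟨hν.1, fun i => ?_⟩
  have h0 := hν.2 0
  have h1 := hν.2 1
  rw [h] at h0 h1
  simp only [inner_add_left, real_inner_smul_left] at h0 h1
  apply mul_left_cancel₀ hD
  fin_cases i
  · simp only [Fin.zero_eta]
    linear_combination pd 1 z w 1 * h0 - pd 0 z w 1 * h1
  · simp only [Fin.mk_one]
    linear_combination pd 0 z w 0 * h1 - pd 1 z w 0 * h0

/-- The components of a minimal surface in conformal parameters are harmonic. -/
theorem laplace_eq_zero {G : E 2 → E n} {z : E 2 → E 2} {s t : Set (E 2)} (hs : IsOpen s)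
    (ht : IsOpen t) (hG : ContDiffOn ℝ 2 G t) (hz : ContDiffOn ℝ 2 z s) (hst : Set.MapsTo z s t)
    (hmin : IsMinimalOn G t) (hconf : IsConformalImmersionOn (G ∘ z) s) {w : E 2} (hw : w ∈ s) :
    pd 0 (pd 0 (G ∘ z)) w + pd 1 (pd 1 (G ∘ z)) w = 0 := by
  have hGw := hG.contDiffAt (ht.mem_nhds (hst hw))
  have hzw := hz.contDiffAt (hs.mem_nhds hw)
  set L := pd 0 (pd 0 (G ∘ z)) w + pd 1 (pd 1 (G ∘ z)) w with hL
  by_contra hne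
  have hn : ‖L‖ ≠ 0 := norm_ne_zero_iff.2 hne
  have htan := inner_laplace_tangent_eq_zero hs (hG.comp hz hst) hconf hw
  -- A nonzero Laplacian, being normal, can itself be normalized and used as the direction `ν`.
  have hν : IsUnitNormalAt (G ∘ z) (‖L‖⁻¹ • L) w := by
    refine ⟨by rw [norm_smul, norm_inv, norm_norm, inv_mul_cancel₀ hn], fun i => ?_⟩
    rw [real_inner_smul_right, real_inner_comm, htan i, mul_zero]
  have hνG := isUnitNormalAt_of_comp (hGw.differentiableAt two_ne_zero)
    (hzw.differentiableAt two_ne_zero) (hconf w hw).1 hν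
  have h := inner_laplace_normal_eq_zero hGw hzw
    (fun y hy => by rw [Set.mem_singleton_iff.1 hy]; exact hconf w hw) hνG
    (hmin _ (hst hw) _ hνG)
  rw [← hL, real_inner_smul_right, real_inner_self_eq_norm_sq] at h
  have : ‖L‖⁻¹ * ‖L‖ ^ 2 ≠ 0 := mul_ne_zero (inv_ne_zero hn) (pow_ne_zero 2 hn)
  exact this h

theorem injective_fderiv_of_areaElement_pos {X : E 2 → E n} {w : E 2} (h : 0 < areaElement X w) :
    Function.Injective (fderiv ℝ X w) := by
  have hdet := areaElement_sq_pos h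
  rw [injective_iff_map_eq_zero]
  intro v hv
  rw [fderiv_apply_eq] at hv
  have h0 := congrArg (fun x => inner ℝ (pd 0 X w) x) hv
  have h1 := congrArg (fun x => inner ℝ (pd 1 X w) x) hv
  simp only [inner_add_right, real_inner_smul_right, inner_zero_right] at h0 h1
  change v 0 * firstForm X 0 0 w + v 1 * firstForm X 0 1 w = 0 at h0
  change v 0 * firstForm X 1 0 w + v 1 * firstForm X 1 1 w = 0 at h1
  rw [firstForm_comm X 1 0] at h1
  ext i
  apply mul_left_cancel₀ hdet.ne'
  fin_cases i
  · simp only [Fin.zero_eta, PiLp.zero_apply, mul_zero]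
    linear_combination firstForm X 1 1 w * h0 - firstForm X 0 1 w * h1
  · simp only [Fin.mk_one, PiLp.zero_apply, mul_zero]
    linear_combination firstForm X 0 0 w * h1 - firstForm X 0 1 w * h0

/-- A reparametrization of an immersion takes interior points to interior points, even if the
reparametrized map is only known on a closed set. -/
theorem mem_interior_of_comp {G : E 2 → E n} {X : E 2 → E n} {z : E 2 → E 2} {s t : Set (E 2)}
    (hs : IsOpen s) (hG : DifferentiableOn ℝ G t) (hz : ContDiffOn ℝ 1 z s)
    (hst : Set.MapsTo z s t) (hX : Set.EqOn X (G ∘ z) s)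
    {w : E 2} (hw : w ∈ s) (hinj : Function.Injective (fderiv ℝ X w)) : z w ∈ interior t := by
  have hzw := hz.contDiffAt (hs.mem_nhds hw)
  have hzs := hzw.hasStrictFDerivAt one_ne_zero
  have h1 := ((hG _ (hst hw)).hasFDerivWithinAt.comp w hzs.hasFDerivAt.hasFDerivWithinAt
    hst).hasFDerivAt (hs.mem_nhds hw)
  have h2 := h1.congr_of_eventuallyEq (Filter.eventuallyEq_of_mem (hs.mem_nhds hw) hX)
  rw [h2.fderiv] at hinj
  have h3 : Function.Injective (fderiv ℝ z w) := by
    rw [ContinuousLinearMap.coe_comp] at hinj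
    exact hinj.of_comp
  -- In equal finite dimensions the injective derivative of `z` is onto, so `z` is open at `w`.
  have h4 : Function.Surjective (fderiv ℝ z w) :=
    LinearMap.injective_iff_surjective (f := (fderiv ℝ z w : E 2 →ₗ[ℝ] E 2)).1 h3
  have h5 := hzs.map_nhds_eq_of_surj (LinearMap.range_eq_top.2 h4)
  rw [mem_interior_iff_mem_nhds, ← h5, Filter.mem_map]
  exact Filter.mem_of_superset (hs.mem_nhds hw) hst

end Conformal

end

/-! ### The two estimates at the centre -/

section

open Metric InnerProductSpace

section Parametrization

variable {m : ℕ} {R : ℝ} {φ : Fin m → E 2 → ℝ} {X : E 2 → E (m + 2)}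

/-- The first two components of a surface in `ℝ^{m+2}`. -/
def planePart (X : E 2 → E (m + 2)) (w : E 2) : E 2 := WithLp.toLp 2 ![X w 0, X w 1]

theorem contDiffOn_planePart {s : Set (E 2)} {k : WithTop ℕ∞} (h : ContDiffOn ℝ k X s) :
    ContDiffOn ℝ k (planePart X) s := by
  rw [contDiffOn_euclidean] at h ⊢
  intro i
  fin_cases i
  · exact h 0
  · exact h 1

theorem IsConformalParametrization.eqOn (h : IsConformalParametrization R φ X) :
    Set.EqOn X (graph φ ∘ planePart X) (closedBall 0 1) ∧
      ContinuousOn (planePart X) (closedBall 0 1) ∧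
      Set.BijOn (planePart X) (closedBall 0 1) (closedBall 0 R) ∧ planePart X 0 = 0 := by
  obtain ⟨z, hc, hb, h0, hX⟩ := h.reparam
  have e : Set.EqOn z (planePart X) (closedBall 0 1) := fun w hw => by
    ext i
    fin_cases i <;> simp [planePart, hX w hw, graph_zero, graph_one]
  refine ⟨fun w hw => ?_, hc.congr e.symm, hb.congr e, ?_⟩
  · rw [Function.comp_apply, ← e hw, hX w hw]
  · rw [← e (by simp), h0]

theorem IsConformalParametrization.mapsTo_ball (hR : 0 < R) (hφ : IsMinimalGraph R φ)
    (h : IsConformalParametrization R φ X) : Set.MapsTo (planePart X) (ball 0 1) (ball 0 R) := by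
  obtain ⟨hX, -, hb, -⟩ := h.eqOn
  intro w hw
  rw [← interior_closedBall _ hR.ne']
  exact mem_interior_of_comp isOpen_ball
    ((contDiffOn_graph hφ.contDiffOn).differentiableOn (by norm_num))
    ((contDiffOn_planePart h.contDiffOn).of_le (by norm_num))
    (hb.mapsTo.mono_left ball_subset_closedBall) (hX.mono ball_subset_closedBall) hw
    (injective_fderiv_of_areaElement_pos (h.conformal w hw).1)

theorem IsConformalParametrization.harmonic (hR : 0 < R) (hφ : IsMinimalGraph R φ)
    (h : IsConformalParametrization R φ X) (ν : E (m + 2)) :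
    HarmonicOnNhd (fun ζ : ℂ => inner ℝ (X (plane ζ)) ν) (ball 0 1) := by
  have hX : Set.EqOn X (graph φ ∘ planePart X) (ball 0 1) := h.eqOn.1.mono ball_subset_closedBall
  have hX2 : ContDiffOn ℝ 2 X (ball 0 1) := h.contDiffOn.of_le (by norm_num)
  have hpd : ∀ i, Set.EqOn (pd i X) (pd i (graph φ ∘ planePart X)) (ball 0 1) :=
    pd_eqOn isOpen_ball hX
  have hconf : IsConformalImmersionOn (graph φ ∘ planePart X) (ball 0 1) := by
    intro w hw
    have := h.conformal w hw
    simpa only [areaElement, firstForm, hpd _ hw] using this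
  refine harmonicOnNhd_comp_plane (u := fun w => inner ℝ (X w) ν)
    (hX2.inner ℝ contDiffOn_const) fun w hw => ?_
  rw [pd_pd_inner_const isOpen_ball hX2 ν 0 0 hw, pd_pd_inner_const isOpen_ball hX2 ν 1 1 hw,
    ← inner_add_left, pd_eqOn isOpen_ball (hpd 0) 0 hw, pd_eqOn isOpen_ball (hpd 1) 1 hw,
    laplace_eq_zero isOpen_ball isOpen_ball
      ((contDiffOn_graph hφ.contDiffOn).mono ball_subset_closedBall |>.of_le (by norm_num))
      (contDiffOn_planePart hX2) (h.mapsTo_ball hR hφ) hφ.minimal hconf hw, inner_zero_left]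

theorem IsConformalParametrization.abs_secondForm_le (hR : 0 < R) (hφ : IsMinimalGraph R φ)
    (h : IsConformalParametrization R φ X) {ν : E (m + 2)} (hν : ‖ν‖ = 1) (i j : Fin 2) :
    |secondForm X ν i j 0| ≤ 40 * graphSupNorm R φ := by
  have hcφ : ∀ k, ContinuousOn (φ k) (closedBall 0 R) := fun k => (hφ.contDiffOn k).continuousOn
  have hM : 0 < graphSupNorm R φ := hR.trans_le (le_graphSupNorm hR.le hcφ)
  have hX2 : ContDiffOn ℝ 2 X (ball 0 1) := h.contDiffOn.of_le (by norm_num)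
  have hb : ∀ ζ ∈ ball (0 : ℂ) 1, |inner ℝ (X (plane ζ)) ν| ≤ graphSupNorm R φ := by
    intro ζ hζ
    have hmem : plane ζ ∈ closedBall (0 : E 2) 1 :=
      ball_subset_closedBall (plane_mem_ball.2 hζ)
    refine (abs_real_inner_le_norm _ _).trans ?_
    rw [hν, mul_one, h.eqOn.1 hmem]
    exact norm_graph_le hcφ (h.eqOn.2.2.1.mapsTo hmem)
  set e : Fin 2 → ℂ := ![1, Complex.I] with he
  have hen : ∀ k, ‖e k‖ = 1 := by intro k; fin_cases k <;> simp [he]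
  have hep : ∀ k, plane (e k) = EuclideanSpace.single k 1 := by
    intro k
    fin_cases k
    · exact plane_one
    · exact plane_I
  have key := norm_fderiv_fderiv_le (h.harmonic hR hφ ν) hM hb (e i) (e j)
  rw [hen, hen, mul_one, mul_one] at key
  have e1 : ∀ (u : E 2 → ℝ) (k : Fin 2) (ζ : ℂ),
      fderiv ℝ (fun ξ => u (plane ξ)) ζ (e k) = pd k u (plane ζ) := by
    intro u k ζ
    rw [fderiv_comp_plane, hep, pd]
  simp only [e1 (fun w => inner ℝ (X w) ν)] at key
  rw [e1, map_zero, pd_pd_inner_const isOpen_ball hX2 ν i j (by simp)] at key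
  exact key

theorem IsConformalParametrization.sq_le_areaElement (hR : 0 < R) (hφ : IsMinimalGraph R φ)
    (h : IsConformalParametrization R φ X) : R ^ 2 / 128 ≤ areaElement X 0 := by
  obtain ⟨hX, hzc, hzb, hz0⟩ := h.eqOn
  set f : ℂ → ℂ := fun ζ => plane.symm (planePart X (plane ζ)) with hf
  have mc : ∀ r : ℝ, Set.BijOn plane (closedBall 0 r) (closedBall 0 r) := fun r =>
    ⟨fun ζ hζ => plane_mem_closedBall.2 hζ, plane.injective.injOn, fun w hw =>
      ⟨plane.symm w, by simpa using hw, by simp⟩⟩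
  have mc' : ∀ r : ℝ, Set.BijOn plane.symm (closedBall 0 r) (closedBall 0 r) := fun r =>
    ⟨fun w hw => by simpa using hw, plane.symm.injective.injOn, fun ζ hζ =>
      ⟨plane ζ, plane_mem_closedBall.2 hζ, by simp⟩⟩
  have hfb : Set.BijOn f (closedBall 0 1) (closedBall 0 R) := (mc' R).comp (hzb.comp (mc 1))
  have hfc : ContinuousOn f (closedBall 0 1) :=
    plane.symm.continuous.comp_continuousOn
      (hzc.comp plane.continuous.continuousOn (mc 1).mapsTo)
  have hfball : Set.MapsTo f (ball 0 1) (ball 0 R) := fun ζ hζ => by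
    have := h.mapsTo_ball hR hφ (plane_mem_ball.2 hζ)
    simpa [hf] using this
  obtain ⟨ψ, hψ⟩ := exists_circleHomeo hR hfc hfb hfball
  have hcoord : ∀ ζ : ℂ, ζ.re = plane ζ 0 ∧ ζ.im = plane ζ 1 := fun ζ => by
    simp [plane]
  have hre : (fun ζ => (f ζ).re)
      = fun ζ => inner ℝ (X (plane ζ)) (EuclideanSpace.single 0 (1 : ℝ)) := by
    ext ζ
    rw [(hcoord _).1, hf]
    simp [planePart, EuclideanSpace.inner_single_right]
  have him : (fun ζ => (f ζ).im)
      = fun ζ => inner ℝ (X (plane ζ)) (EuclideanSpace.single 1 (1 : ℝ)) := by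
    ext ζ
    rw [(hcoord _).2, hf]
    simp [planePart, EuclideanSpace.inner_single_right]
  have hz := hψ.heinz hR hfc (by simp [hf, hz0]) (hre ▸ h.harmonic hR hφ _)
    (him ▸ h.harmonic hR hφ _)
  have hXd : DifferentiableAt ℝ X 0 :=
    (h.contDiffOn.contDiffAt (isOpen_ball.mem_nhds (by simp))).differentiableAt (by norm_num)
  rw [hre, him, fderiv_comp_plane_one (fun w => inner ℝ (X w) (EuclideanSpace.single 0 (1 : ℝ))),
    fderiv_comp_plane_one (fun w => inner ℝ (X w) (EuclideanSpace.single 1 (1 : ℝ))),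
    fderiv_comp_plane_I (fun w => inner ℝ (X w) (EuclideanSpace.single 0 (1 : ℝ))),
    fderiv_comp_plane_I (fun w => inner ℝ (X w) (EuclideanSpace.single 1 (1 : ℝ))), map_zero] at hz
  simp only [pd_inner_const hXd] at hz
  simp only [EuclideanSpace.inner_single_right, conj_trivial, one_mul] at hz
  have n0 := sq_add_sq_le_norm_sq (pd 0 X 0)
  have n1 := sq_add_sq_le_norm_sq (pd 1 X 0)
  obtain ⟨-, w0, w1, -⟩ := h.conformal 0 (by simp)
  rw [firstForm, real_inner_self_eq_norm_sq] at w0 w1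
  rw [w0] at n0
  rw [w1] at n1
  -- Cauchy–Schwarz; with `|X_u|² = |X_v|² = W` it turns Heinz's bound into `(R / 4)² ≤ 4 * 2W`,
  -- whence the `128`.
  have s : ∀ a b c d : ℝ, (|a| + |b| + (|c| + |d|)) ^ 2 ≤ 4 * (a ^ 2 + b ^ 2 + c ^ 2 + d ^ 2) := by
    intro a b c d
    rw [← sq_abs a, ← sq_abs b, ← sq_abs c, ← sq_abs d]
    nlinarith [sq_nonneg (|a| - |b|), sq_nonneg (|a| - |c|), sq_nonneg (|a| - |d|),
      sq_nonneg (|b| - |c|), sq_nonneg (|b| - |d|), sq_nonneg (|c| - |d|)]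
  have t := (pow_le_pow_left₀ (by positivity) hz 2).trans (s _ _ _ _)
  linarith

end Parametrization

end

end MinimalGraph

theorem mainTheorem1 :
    ∃ Θ : ℝ, 0 ≤ Θ ∧
      ∀ (m : ℕ) (_ : 1 ≤ m) (R : ℝ) (_ : 0 < R)
        (φ : Fin m → MinimalGraph.E 2 → ℝ) (_ : MinimalGraph.IsMinimalGraph R φ)
        (X : MinimalGraph.E 2 → MinimalGraph.E (m + 2))
        (_ : MinimalGraph.IsConformalParametrization R φ X)
        (N : MinimalGraph.E 2 → MinimalGraph.E (m + 2))
        (_ : ∀ w ∈ Metric.ball (0 : MinimalGraph.E 2) 1, MinimalGraph.IsUnitNormalAt X (N w) w),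
        |MinimalGraph.gaussCurvature X (N 0) 0| ≤
          Θ / R ^ 4 * MinimalGraph.graphSupNorm R φ ^ 2 := by
  -- The numerator is at most `2 (40 M)²` and the denominator at least `(R² / 128)²`.
  refine ⟨2 * 40 ^ 2 * 128 ^ 2, by norm_num, fun m _ R hR φ hφ X hX N hN => ?_⟩
  have hL := hX.abs_secondForm_le hR hφ (hN 0 (by simp)).1
  have hW := hX.sq_le_areaElement hR hφ
  set M := MinimalGraph.graphSupNorm R φ
  have hM : 0 ≤ 40 * M := (abs_nonneg _).trans (hL 0 0)
  rw [MinimalGraph.gaussCurvature, abs_div,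
    abs_of_nonneg (sq_nonneg (MinimalGraph.areaElement X 0))]
  have hnum : |MinimalGraph.secondForm X (N 0) 0 0 0 * MinimalGraph.secondForm X (N 0) 1 1 0
      - MinimalGraph.secondForm X (N 0) 0 1 0 ^ 2| ≤ 2 * (40 * M) ^ 2 := by
    refine (abs_sub _ _).trans ?_
    rw [abs_mul, abs_pow]
    have a := mul_le_mul (hL 0 0) (hL 1 1) (abs_nonneg _) hM
    have b := pow_le_pow_left₀ (abs_nonneg _) (hL 0 1) 2
    linarith
  have hden : (R ^ 2 / 128) ^ 2 ≤ MinimalGraph.areaElement X 0 ^ 2 :=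
    pow_le_pow_left₀ (by positivity) hW 2
  calc _ ≤ 2 * (40 * M) ^ 2 / (R ^ 2 / 128) ^ 2 :=
        div_le_div₀ (by positivity) hnum (by positivity) hden
    _ = _ := by field_simp
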